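/- For integers $n,m\ge 1$ let $G_{n,m}=C_n\times P_m$ be the Cartesian product of the cycle on $\mathbb Z_n$ and the path on $\{0,\dots,m-1\}$ (as simple graphs: loops are dropped for $n=1$ and parallel edges identified for $n=2$), with rings $R_k=\{(i,k): i\in\mathbb Z_n\}$, $0\le k\le m-1$. Let $G^{s}_{n,m}$ be the simple graph obtained by adding a new vertex $s$ (the sink) joined by one edge to each vertex of $R_0\cup R_{m-1}$. An $s$-rooted trunk of a spanning tree $T$ of $G^s_{n,m}$ is a simple path $L\subset T$ that contains $s$ and meets every ring $R_k$, $0\le k\le m-1$. A branch of $L$ in $T$ is a simple path in $T$ that has exactly one endpoint on $L$ and no other vertex in common with $L$, and that is maximal by inclusion among such paths; its length is its number of edges. **Theorem.** For every $n\ge 1$ there are constants $C(n)>0$ and $\theta=\theta(n)\in(0,1)$, depending only on $n$, such that the following holds for every $m\ge 1$. If $T$ is a uniformly random spanning tree of $G^s_{n,m}$, then one can choose, for each spanning tree $T$, an $s$-rooted trunk $L=L(T)\subset T$ (the choice not depending on $l$) such that for every integer $l\ge 0$ $$\mathbb P\bigl(T\text{ has a branch off }L(T)\text{ of length}\ge l\bigr)\;\le\;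 m\,C(n)\,\theta^{\,l}.$$ -/

import Mathlib

open MeasureTheory

/-- The cylindrical graph `C_n × P_m` (Cartesian product of the cycle and the path), on the
vertices `(i, j)`, `i ∈ {0, …, n-1}` taken modulo `n`, `j ∈ {0, …, m-1}`. -/
abbrev cylinderGraph (n m : ℕ) : SimpleGraph (Fin n × Fin m) :=
  (SimpleGraph.cycleGraph n).boxProd (SimpleGraph.pathGraph m)

/-- Vertices lying on one of the two boundary rings `R_0` and `R_{m-1}`. -/
def OnBoundary {n m : ℕ} (v : Fin n × Fin m) : Prop :=
  (v.2 : ℕ) = 0 ∨ (v.2 : ℕ) + 1 = m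

/-- The cylindrical graph with a sink: the sink is the additional vertex `none`, and it is joined
to all vertices of the two boundary rings. -/
def sinkCylinder (n m : ℕ) : SimpleGraph (Option (Fin n × Fin m)) where
  Adj x y :=
    match x, y with
    | some u, some v => (cylinderGraph n m).Adj u v
    | none, some v => OnBoundary v
    | some u, none => OnBoundary u
    | none, none => False
  symm := ⟨by
    rintro (_ | u) (_ | v) h
    · exact h
    · exact h
    · exact h
    · exact SimpleGraph.Adj.symm (G := cylinderGraph n m) h⟩
  loopless := ⟨by
    rintro (_ | u) h
    · exact h
    · exact SimpleGraph.irrefl (cylinderGraph n m) h⟩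

theorem sinkCylinder_connected (n m : ℕ) : (sinkCylinder n m).Connected := by
  have key : ∀ x, (sinkCylinder n m).Reachable none x := by
    rintro (_ | ⟨i, j⟩)
    · exact SimpleGraph.Reachable.refl _
    · obtain ⟨j, hj⟩ := j
      induction j with
      | zero =>
        exact SimpleGraph.Adj.reachable (show OnBoundary _ from Or.inl rfl)
      | succ k ih =>
        refine (ih (by omega)).trans (SimpleGraph.Adj.reachable ?_)
        change (cylinderGraph n m).Adj _ _
        rw [SimpleGraph.boxProd_adj]
        right
        simp [SimpleGraph.pathGraph_adj]
  have : Nonempty (Option (Fin n × Fin m)) := ⟨none⟩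
  exact SimpleGraph.Connected.mk fun x y => (key x).symm.trans (key y)

section Trees

variable {V : Type*}

/-- The spanning trees of `G`, as graphs on the vertex set of `G`. -/
abbrev SpanningTree (G : SimpleGraph V) : Type _ :=
  {T : SimpleGraph V // T ≤ G ∧ T.IsTree}

instance (G : SimpleGraph V) : MeasurableSpace (SpanningTree G) := ⊤

theorem SpanningTree.nonempty [Finite V] {G : SimpleGraph V} (hG : G.Connected) :
    Nonempty (SpanningTree G) := by
  obtain ⟨T, h1, h2⟩ := hG.exists_isTree_le
  exact ⟨⟨T, h1, h2⟩⟩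

/-- The law of the uniform spanning tree of a finite connected graph. -/
noncomputable def ust [Finite V] (G : SimpleGraph V) (hG : G.Connected) :
    Measure (SpanningTree G) :=
  haveI : Fintype (SpanningTree G) := Fintype.ofFinite _
  haveI : Nonempty (SpanningTree G) := SpanningTree.nonempty hG
  (PMF.uniformOfFintype (SpanningTree G)).toMeasure

/-- `p` is a simple path in `T` with its initial vertex on `L`, its final vertex off `L`, and no
vertex on `L` besides the initial one. -/
def LeavesTrunk {T : SimpleGraph V} (L : T.Subgraph) {u v : V} (p : T.Walk u v) : Prop :=
  p.IsPath ∧ u ∈ L.verts ∧ v ∉ L.verts ∧ ∀ w ∈ p.support, w ∈ L.verts → w = u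

/-- A branch of `L` in `T`: a path as in `LeavesTrunk` that is maximal by inclusion among all
such paths. -/
def IsBranch {T : SimpleGraph V} (L : T.Subgraph) {u v : V} (p : T.Walk u v) : Prop :=
  LeavesTrunk L p ∧
    ∀ (u' v' : V) (q : T.Walk u' v'), LeavesTrunk L q →
      p.toSubgraph ≤ q.toSubgraph → q.toSubgraph = p.toSubgraph

/-- `T` has a branch off `L` of length (number of edges) at least `l`. -/
def HasBranchOfLengthGE {T : SimpleGraph V} (L : T.Subgraph) (l : ℕ) : Prop :=
  ∃ (u v : V) (p : T.Walk u v), IsBranch L p ∧ l ≤ p.length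

end Trees

/-- `L` is an `s`-rooted trunk of `T`: a simple path in `T` that contains the sink and meets every
ring of the cylinder. -/
def IsSinkTrunk {n m : ℕ} {T : SimpleGraph (Option (Fin n × Fin m))} (L : T.Subgraph) : Prop :=
  (∃ (u v : Option (Fin n × Fin m)) (p : T.Walk u v), p.IsPath ∧ L = p.toSubgraph) ∧
    none ∈ L.verts ∧
    ∀ k : Fin m, ∃ i : Fin n, some (i, k) ∈ L.verts

/-! A branch of length `l` avoids the sink after its first vertex, so it spans about `l / n`
consecutive rings. The trunk consists of at most two arms leaving the sink, and it crosses every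
pair of consecutive rings except at most one. Branch and trunk are disjoint, so a long branch forces
a long run of doubly crossed bands (`HasBranchOfLengthGE.exists_doublyCrossed`).

Such runs are exponentially rare. Any tree can be rewired inside one band so that it crosses the
band at most once, and at most N = `bandCount n` trees have the same image. Each of the disjoint
bands in the run therefore costs a factor N / (N + 1) (`card_forall_doublyCrossed_le`). A union
bound over the starting ring gives the factor `m`. -/

/-! ### Rewiring a spanning tree inside a band, and counting. -/

section Surgery

variable {n m : ℕ}

/-- The vertices of the two consecutive rings `R_k` and `R_{k+1}`. -/
def InBand (k : ℕ) (x : Option (Fin n × Fin m)) : Prop :=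
  ∃ v, x = some v ∧ ((v.2 : ℕ) = k ∨ (v.2 : ℕ) = k + 1)

/-- Two graphs agree on all edges that do not lie within the band of `R_k` and `R_{k+1}`. -/
def AgreeOffBand (k : ℕ) (T T' : SimpleGraph (Option (Fin n × Fin m))) : Prop :=
  ∀ x y, ¬ (InBand k x ∧ InBand k y) → (T.Adj x y ↔ T'.Adj x y)

/-- At least two edges of `T` join the rings `R_k` and `R_{k+1}`. -/
def DoublyCrossed (k : ℕ) (T : SimpleGraph (Option (Fin n × Fin m))) : Prop :=
  ∃ (h : k + 1 < m) (i j : Fin n), i ≠ j ∧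
    T.Adj (some (i, ⟨k, by omega⟩)) (some (i, ⟨k + 1, h⟩)) ∧
    T.Adj (some (j, ⟨k, by omega⟩)) (some (j, ⟨k + 1, h⟩))

/-- Bands whose lower rings are at least two apart share no vertex. -/
theorem AgreeOffBand.doublyCrossed {k k' : ℕ} {T T' : SimpleGraph (Option (Fin n × Fin m))}
    (h : AgreeOffBand k T T') (hk : k' + 2 ≤ k) (hT : DoublyCrossed k' T) :
    DoublyCrossed k' T' := by
  obtain ⟨hm, i, j, hij, h1, h2⟩ := hT
  refine ⟨hm, i, j, hij, (h _ _ ?_).1 h1, (h _ _ ?_).1 h2⟩ <;>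
  · rintro ⟨⟨v, hv, hv'⟩, -⟩
    obtain rfl := Option.some.inj hv
    simp only at hv'
    omega

/-- The edges of `T` outside the band. -/
def offBand (k : ℕ) (T : SimpleGraph (Option (Fin n × Fin m))) :
    SimpleGraph (Option (Fin n × Fin m)) where
  Adj x y := T.Adj x y ∧ ¬ (InBand k x ∧ InBand k y)
  symm := ⟨fun _ _ h => ⟨h.1.symm, fun h' => h.2 h'.symm⟩⟩
  loopless := ⟨fun _ h => T.irrefl h.1⟩

/-- The two rings of the band, and the single edge between them at position `i`. -/
def singleCrossing (n m k : ℕ) (i : Fin n) : SimpleGraph (Option (Fin n × Fin m)) where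
  Adj x y := (sinkCylinder n m).Adj x y ∧ InBand k x ∧ InBand k y ∧
    ∀ u v, x = some u → y = some v → u.2 = v.2 ∨ (u.1 = i ∧ v.1 = i)
  symm := ⟨fun _ _ h => ⟨h.1.symm, h.2.2.1, h.2.1, fun u v hu hv =>
    (h.2.2.2 v u hv hu).imp Eq.symm And.symm⟩⟩
  loopless := ⟨fun _ h => (sinkCylinder n m).irrefl h.1⟩

theorem singleCrossing_reachable_ring {k : ℕ} (i : Fin n) (j : Fin m)
    (hj : (j : ℕ) = k ∨ (j : ℕ) = k + 1) (a b : Fin n) :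
    (singleCrossing n m k i).Reachable (some (a, j)) (some (b, j)) := by
  let f : SimpleGraph.cycleGraph n →g singleCrossing n m k i :=
    { toFun := fun a => some (a, j)
      map_rel' := by
        intro a b hab
        refine ⟨?_, ⟨_, rfl, hj⟩, ⟨_, rfl, hj⟩, ?_⟩
        · change (cylinderGraph n m).Adj _ _
          rw [SimpleGraph.boxProd_adj]
          exact Or.inl ⟨hab, rfl⟩
        · intro u v hu hv
          obtain rfl := Option.some.inj hu
          obtain rfl := Option.some.inj hv
          exact Or.inl rfl }
  exact (SimpleGraph.cycleGraph_preconnected a b).map f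

theorem singleCrossing_reachable {k : ℕ} (i : Fin n) (hk : k + 1 < m)
    {x y : Option (Fin n × Fin m)} (hx : InBand k x) (hy : InBand k y) :
    (singleCrossing n m k i).Reachable x y := by
  have key : ∀ x : Option (Fin n × Fin m), InBand k x →
      (singleCrossing n m k i).Reachable x (some (i, ⟨k, by omega⟩)) := by
    rintro _ ⟨⟨a, j⟩, rfl, hj⟩
    refine (singleCrossing_reachable_ring i j hj a i).trans ?_
    rcases hj with hj | hj
    · have : j = ⟨k, by omega⟩ := Fin.ext hj
      rw [this]
    · refine SimpleGraph.Adj.reachable ⟨?_, ⟨_, rfl, Or.inr hj⟩, ⟨_, rfl, Or.inl rfl⟩, ?_⟩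
      · change (cylinderGraph n m).Adj _ _
        rw [SimpleGraph.boxProd_adj]
        refine Or.inr ⟨?_, rfl⟩
        rw [SimpleGraph.pathGraph_adj]
        exact Or.inr hj.symm
      · intro u v hu hv
        obtain rfl := Option.some.inj hu
        obtain rfl := Option.some.inj hv
        exact Or.inr ⟨rfl, rfl⟩
  exact (key x hx).trans (key y hy).symm

/-- Any spanning tree can be changed within a band so that the band is crossed at most once. -/
theorem exists_agreeOffBand_not_doublyCrossed (hn : 1 ≤ n) (k : ℕ)
    (T : SpanningTree (sinkCylinder n m)) :
    ∃ T' : SpanningTree (sinkCylinder n m),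
      AgreeOffBand k T.1 T'.1 ∧ ¬ DoublyCrossed k T'.1 := by
  by_cases hk : k + 1 < m
  swap
  · exact ⟨T, fun _ _ _ => Iff.rfl, fun h => hk h.1⟩
  let i : Fin n := ⟨0, hn⟩
  obtain ⟨T, hTG, hT⟩ := T
  have hle : offBand k T ≤ T := fun _ _ h => h.1
  have hconn : (offBand k T ⊔ singleCrossing n m k i).Connected := by
    have hstep : ∀ x y, T.Adj x y →
        (offBand k T ⊔ singleCrossing n m k i).Reachable x y := by
      intro x y hxy
      by_cases hb : InBand k x ∧ InBand k y
      · exact (singleCrossing_reachable i hk hb.1 hb.2).mono le_sup_right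
      · exact SimpleGraph.Adj.reachable (Or.inl ⟨hxy, hb⟩)
    have hwalk : ∀ x y, T.Walk x y →
        (offBand k T ⊔ singleCrossing n m k i).Reachable x y := by
      intro x y p
      induction p with
      | nil => exact SimpleGraph.Reachable.refl _
      | cons h _ ih => exact (hstep _ _ h).trans ih
    have : Nonempty (Option (Fin n × Fin m)) := ⟨none⟩
    exact SimpleGraph.Connected.mk fun x y => hwalk x y (hT.connected.preconnected x y).some
  -- Extending the forest `offBand k T` to a tree keeps every edge outside the band. All new edges
  -- come from `singleCrossing`, so they can cross only at `i`.
  obtain ⟨F, hF1, hF2, hF3⟩ := hconn.exists_isTree_le_of_le_of_isAcyclic le_sup_left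
    (hT.isAcyclic.anti hle)
  have hcross : ∀ a : Fin n, F.Adj (some (a, ⟨k, by omega⟩)) (some (a, ⟨k + 1, hk⟩)) → a = i := by
    intro a ha
    rcases hF2 ha with h | h
    · exact absurd ⟨⟨_, rfl, Or.inl rfl⟩, ⟨_, rfl, Or.inr rfl⟩⟩ h.2
    · rcases h.2.2.2 _ _ rfl rfl with h' | h'
      · have := congrArg Fin.val h'
        simp at this
      · exact h'.1
  refine ⟨⟨F, fun x y h => ?_, hF3⟩, fun x y hxy => ⟨fun h => hF1 ⟨h, hxy⟩, fun h => ?_⟩, ?_⟩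
  · rcases hF2 h with h | h
    · exact hTG h.1
    · exact h.1
  · rcases hF2 h with h | h
    · exact h.1
    · exact absurd ⟨h.2.1, h.2.2.1⟩ hxy
  · rintro ⟨_, a, b, hab, h1, h2⟩
    exact hab ((hcross a h1).trans (hcross b h2).symm)

/-- The number of graphs on the vertices of a band. -/
def bandCount (n : ℕ) : ℕ := 2 ^ (n * 2 * (n * 2))

/-- A tree that agrees with `T'` off the band is determined by its adjacency relation on the `2 * n`
band vertices. -/
theorem card_agreeOffBand_le [Fintype (SpanningTree (sinkCylinder n m))] {k : ℕ} (hk : k + 1 < m)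
    (T' : SpanningTree (sinkCylinder n m)) (S : Finset (SpanningTree (sinkCylinder n m)))
    (hS : ∀ T ∈ S, AgreeOffBand k T.1 T'.1) : S.card ≤ bandCount n := by
  classical
  let e : Fin n × Fin 2 → Option (Fin n × Fin m) := fun p => some (p.1, ⟨k + p.2, by omega⟩)
  have he : ∀ x, InBand k x → ∃ p, e p = x := by
    rintro _ ⟨⟨i, j⟩, rfl, hj | hj⟩
    · exact ⟨(i, 0), by simp only [e]; congr; exact hj.symm⟩
    · exact ⟨(i, 1), by simp only [e]; congr; exact hj.symm⟩
  let f : SpanningTree (sinkCylinder n m) → ((Fin n × Fin 2) × (Fin n × Fin 2) → Prop) :=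
    fun T p => T.1.Adj (e p.1) (e p.2)
  have hcard : bandCount n =
      (Finset.univ : Finset ((Fin n × Fin 2) × (Fin n × Fin 2) → Prop)).card := by
    simp [bandCount]
  rw [hcard]
  refine Finset.card_le_card_of_injOn f (fun _ _ => Finset.mem_coe.2 (Finset.mem_univ _)) ?_
  intro T₁ h₁ T₂ h₂ h
  apply Subtype.ext
  ext x y
  by_cases hb : InBand k x ∧ InBand k y
  · obtain ⟨p, rfl⟩ := he x hb.1
    obtain ⟨q, rfl⟩ := he y hb.2
    exact iff_of_eq (congrFun h (p, q))
  · exact (hS T₁ h₁ x y hb).trans (hS T₂ h₂ x y hb).symm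

-- Induction on `q`: surgery in the top band leaves the lower bands untouched. It thus maps the
-- trees of `A` doubly crossed there, at most N to one, to trees of `A` that are not.
open Classical in
theorem card_forall_doublyCrossed_le [Fintype (SpanningTree (sinkCylinder n m))] (hn : 1 ≤ n)
    (a q : ℕ) :
    (bandCount n + 1) ^ q * (Finset.univ.filter fun T : SpanningTree (sinkCylinder n m) =>
        ∀ j < q, DoublyCrossed (a + 2 * j) T.1).card ≤
      bandCount n ^ q * Fintype.card (SpanningTree (sinkCylinder n m)) := by
  induction q with
  | zero => simp
  | succ q ih =>
    set A := Finset.univ.filter fun T : SpanningTree (sinkCylinder n m) =>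
        ∀ j < q, DoublyCrossed (a + 2 * j) T.1 with hA
    let P : SpanningTree (sinkCylinder n m) → Prop := fun T => DoublyCrossed (a + 2 * q) T.1
    have hset : (Finset.univ.filter fun T : SpanningTree (sinkCylinder n m) =>
        ∀ j < q + 1, DoublyCrossed (a + 2 * j) T.1) = A.filter P := by
      ext T
      simp only [hA, P, Finset.mem_filter, Finset.mem_univ, true_and]
      refine ⟨fun h => ⟨fun j hj => h j (by omega), h q (by omega)⟩, fun h j hj => ?_⟩
      rcases Nat.lt_succ_iff_lt_or_eq.1 hj with hj | rfl
      · exact h.1 j hj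
      · exact h.2
    rw [hset]
    choose Φ hΦ1 hΦ2 using exists_agreeOffBand_not_doublyCrossed (m := m) hn (a + 2 * q)
    have hfib : (A.filter P).card ≤ bandCount n * (A.filter fun T => ¬ P T).card := by
      refine Finset.card_le_mul_card_image_of_maps_to (f := Φ) ?_ _ ?_
      · intro T hT
        simp only [hA, P, Finset.mem_filter, Finset.mem_univ, true_and] at hT ⊢
        exact ⟨fun j hj => (hΦ1 T).doublyCrossed (by omega) (hT.1 j hj), hΦ2 T⟩
      · intro T' _
        rcases Finset.eq_empty_or_nonempty ({T ∈ A.filter P | Φ T = T'}) with h | ⟨T₀, hT₀⟩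
        · simp [h]
        · simp only [P, Finset.mem_filter] at hT₀
          refine card_agreeOffBand_le hT₀.1.2.1 T' _ fun T hT => ?_
          have := (Finset.mem_filter.1 hT).2
          exact this ▸ hΦ1 T
    have hsum := Finset.card_filter_add_card_filter_not (s := A) P
    have hstep : (bandCount n + 1) * (A.filter P).card ≤ bandCount n * A.card := by
      rw [← hsum]
      nlinarith
    calc (bandCount n + 1) ^ (q + 1) * (A.filter P).card
        = (bandCount n + 1) ^ q * ((bandCount n + 1) * (A.filter P).card) := by ring
      _ ≤ (bandCount n + 1) ^ q * (bandCount n * A.card) := Nat.mul_le_mul_left _ hstep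
      _ = bandCount n * ((bandCount n + 1) ^ q * A.card) := by ring
      _ ≤ bandCount n * (bandCount n ^ q * Fintype.card (SpanningTree (sinkCylinder n m))) :=
        Nat.mul_le_mul_left _ ih
      _ = _ := by ring

end Surgery

/-! ### Walks avoiding the sink cannot skip a ring. -/

section Crossings

variable {n m : ℕ} {T : SimpleGraph (Option (Fin n × Fin m))}

/-- Some edge of `T` with both ends in `S` joins the rings `R_k` and `R_{k+1}`. -/
def CrossedWithin (T : SimpleGraph (Option (Fin n × Fin m))) (S : Set (Option (Fin n × Fin m)))
    (k : ℕ) : Prop :=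
  ∃ (i : Fin n) (h : k + 1 < m),
    T.Adj (some (i, ⟨k, by omega⟩)) (some (i, ⟨k + 1, h⟩)) ∧
      some (i, ⟨k, by omega⟩) ∈ S ∧ some (i, ⟨k + 1, h⟩) ∈ S

theorem CrossedWithin.mono {S S' : Set (Option (Fin n × Fin m))} {k : ℕ} (hS : S ⊆ S')
    (h : CrossedWithin T S k) : CrossedWithin T S' k := by
  obtain ⟨i, hk, h1, h2, h3⟩ := h
  exact ⟨i, hk, h1, hS h2, hS h3⟩

theorem CrossedWithin.doublyCrossed {S S' : Set (Option (Fin n × Fin m))} {k : ℕ}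
    (h : CrossedWithin T S k) (h' : CrossedWithin T S' k) (hd : ∀ x ∈ S, x ∉ S') :
    DoublyCrossed k T := by
  obtain ⟨i, hk, h1, h2, -⟩ := h
  obtain ⟨j, _, h1', h2', -⟩ := h'
  refine ⟨hk, i, j, ?_, h1, h1'⟩
  rintro rfl
  exact hd _ h2 h2'

/-- A discrete intermediate value argument: off the sink, an edge changes the ring index by at most
one. -/
theorem crossedWithin_support (hT : T ≤ sinkCylinder n m) {u v : Fin n × Fin m}
    (p : T.Walk (some u) (some v)) (hp : none ∉ p.support) {k : ℕ} (hu : (u.2 : ℕ) ≤ k)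
    (hv : k < v.2) : CrossedWithin T {x | x ∈ p.support} k := by
  obtain ⟨d, hd, ⟨⟨a, j⟩, hx, hj⟩, h2⟩ := p.exists_boundary_dart
    {x | ∃ w : Fin n × Fin m, x = some w ∧ (w.2 : ℕ) ≤ k} ⟨u, rfl, hu⟩ (by
      rintro ⟨w, hw, hw'⟩
      obtain rfl := Option.some.inj hw
      omega)
  have hfst := p.dart_fst_mem_support_of_mem_darts hd
  have hsnd := p.dart_snd_mem_support_of_mem_darts hd
  have hadj := d.adj
  rcases hy : d.snd with _ | ⟨b, j'⟩
  · exact absurd (hy ▸ hsnd) hp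
  · have hj' : k < j' := by
      by_contra h
      exact h2 ⟨_, hy, not_lt.1 h⟩
    rw [hx] at hfst hadj
    rw [hy] at hsnd hadj
    have hG : (cylinderGraph n m).Adj (a, j) (b, j') := hT hadj
    rw [SimpleGraph.boxProd_adj, SimpleGraph.pathGraph_adj] at hG
    simp only at hj hG
    rcases hG with ⟨-, h⟩ | ⟨h, rfl⟩
    · subst h; omega
    · have e1 : j = ⟨k, by omega⟩ := Fin.ext (by simp only; omega)
      have e2 : j' = ⟨k + 1, by omega⟩ := Fin.ext (by simp only; omega)
      rw [e1] at hfst hadj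
      rw [e2] at hsnd hadj
      exact ⟨a, by omega, hadj, hfst, hsnd⟩

theorem exists_mem_support_ring (hT : T ≤ sinkCylinder n m) {u v : Fin n × Fin m}
    (p : T.Walk (some u) (some v)) (hp : none ∉ p.support) {k : Fin m} (hu : u.2 ≤ k)
    (hv : k ≤ v.2) : ∃ i : Fin n, some (i, k) ∈ p.support := by
  rcases hv.eq_or_lt with rfl | hlt
  · exact ⟨v.1, p.end_mem_support⟩
  · obtain ⟨i, _, -, h, -⟩ := crossedWithin_support hT p hp (k := k) hu hlt
    exact ⟨i, h⟩

end Crossings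

/-! ### Walks inside the support of a given walk. -/

section Walks

variable {V : Type*} {T : SimpleGraph V}

theorem exists_walk_within_support {a b x y : V} (q : T.Walk a b) (hx : x ∈ q.support)
    (hy : y ∈ q.support) : ∃ r : T.Walk x y, ∀ z ∈ r.support, z ∈ q.support := by
  classical
  refine ⟨(q.takeUntil x hx).reverse.append (q.takeUntil y hy), fun z hz => ?_⟩
  rw [SimpleGraph.Walk.mem_support_append_iff, SimpleGraph.Walk.support_reverse,
    List.mem_reverse] at hz
  exact hz.elim (fun h => q.support_takeUntil_subset_support hx h)
    (fun h => q.support_takeUntil_subset_support hy h)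

theorem SimpleGraph.Walk.IsPath.exists_walk_avoiding_start {s b x y : V} {q : T.Walk s b}
    (hq : q.IsPath) (hx : x ∈ q.support) (hy : y ∈ q.support) (hxs : x ≠ s) (hys : y ≠ s) :
    ∃ r : T.Walk x y, s ∉ r.support ∧ ∀ z ∈ r.support, z ∈ q.support := by
  cases q with
  | nil => exact absurd (by simpa using hx) hxs
  | cons h q =>
    rw [SimpleGraph.Walk.cons_isPath_iff] at hq
    rw [SimpleGraph.Walk.support_cons, List.mem_cons] at hx hy
    obtain ⟨r, hr⟩ := exists_walk_within_support q (hx.resolve_left hxs) (hy.resolve_left hys)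
    exact ⟨r, fun hs => hq.2 (hr _ hs), fun z hz => List.mem_cons_of_mem _ (hr z hz)⟩

end Walks

/-! ### Long branches force doubly crossed bands. -/

section Branches

variable {n m : ℕ} {T : SimpleGraph (Option (Fin n × Fin m))}

/-- A trunk crosses all pairs of consecutive rings but at most one. -/
theorem IsSinkTrunk.crossedWithin_or {L : T.Subgraph} (hL : IsSinkTrunk L)
    (hT : T ≤ sinkCylinder n m) {k k' : ℕ} (hkk : k < k') (hk' : k' + 1 < m) :
    CrossedWithin T L.verts k ∨ CrossedWithin T L.verts k' := by
  classical
  obtain ⟨⟨u, v, p, hp, rfl⟩, hs, hring⟩ := hL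
  rw [p.mem_verts_toSubgraph] at hs
  have arm : ∀ (w : Option (Fin n × Fin m)) (q : T.Walk none w), q.IsPath →
      (∀ z ∈ q.support, z ∈ p.support) → ∀ (x y : Fin n × Fin m) (j : ℕ),
      some x ∈ q.support → some y ∈ q.support → (x.2 : ℕ) ≤ j → j < y.2 →
      CrossedWithin T p.toSubgraph.verts j := by
    intro w q hq hqp x y j hx hy hxj hjy
    obtain ⟨r, hr1, hr2⟩ := hq.exists_walk_avoiding_start hx hy (by simp) (by simp)
    refine (crossedWithin_support hT r hr1 hxj hjy).mono fun z hz => ?_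
    rw [p.mem_verts_toSubgraph]
    exact hqp _ (hr2 _ hz)
  have hq1 := (hp.takeUntil hs).reverse
  have hq2 := hp.dropUntil hs
  have hs1 : ∀ z ∈ (p.takeUntil none hs).reverse.support, z ∈ p.support := fun z hz =>
    p.support_takeUntil_subset_support hs (by simpa using hz)
  have hs2 : ∀ z ∈ (p.dropUntil none hs).support, z ∈ p.support := fun z hz =>
    p.support_dropUntil_subset_support hs hz
  have hcov : ∀ z ∈ p.support, z ∈ (p.takeUntil none hs).reverse.support ∨
      z ∈ (p.dropUntil none hs).support := by
    intro z hz
    rw [← p.take_spec hs, SimpleGraph.Walk.mem_support_append_iff] at hz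
    simpa using hz
  -- Pigeonhole: of three trunk vertices in rings `k`, `k + 1`, `k' + 1`, two lie on the same arm.
  -- That arm crosses at `k` or at `k'`.
  obtain ⟨a, ha⟩ := hring ⟨k, by omega⟩
  obtain ⟨b, hb⟩ := hring ⟨k + 1, by omega⟩
  obtain ⟨c, hc⟩ := hring ⟨k' + 1, hk'⟩
  rw [p.mem_verts_toSubgraph] at ha hb hc
  have c1 := arm _ _ hq1 hs1
  have c2 := arm _ _ hq2 hs2
  rcases hcov _ ha with ha | ha <;> rcases hcov _ hb with hb | hb <;>
    rcases hcov _ hc with hc | hc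
  · exact Or.inl (c1 _ _ k ha hb (by simp) (by simp))
  · exact Or.inl (c1 _ _ k ha hb (by simp) (by simp))
  · exact Or.inl (c1 _ _ k ha hc (by simp) (by simp only; omega))
  · exact Or.inr (c2 _ _ k' hb hc (by simp only; omega) (by simp))
  · exact Or.inr (c1 _ _ k' hb hc (by simp only; omega) (by simp))
  · exact Or.inl (c2 _ _ k ha hc (by simp) (by simp only; omega))
  · exact Or.inl (c2 _ _ k ha hb (by simp) (by simp))
  · exact Or.inl (c2 _ _ k ha hb (by simp) (by simp))

/-- A path avoiding the sink within `D + 1` consecutive rings has at most `n * (D + 1)`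
vertices. -/
theorem card_support_le_of_ring_le {x y : Option (Fin n × Fin m)} (q : T.Walk x y)
    (hq : q.IsPath) (hs : none ∉ q.support) (D : ℕ)
    (hD : ∀ u v : Fin n × Fin m, some u ∈ q.support → some v ∈ q.support →
      (v.2 : ℕ) ≤ u.2 + D) : q.support.length ≤ n * (D + 1) := by
  classical
  let S : Finset (Fin n × Fin m) := Finset.univ.filter fun u => some u ∈ q.support
  have hS : q.support.length = S.card := by
    rw [← List.toFinset_card_of_nodup hq.support_nodup,
      ← Finset.card_map Function.Embedding.some (s := S)]
    congr 1
    ext (_ | z)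
    · simp [hs]
    · simp [S]
  rw [hS]
  rcases S.eq_empty_or_nonempty with h | h
  · simp [h]
  obtain ⟨u, hu, hmin⟩ := S.exists_min_image (fun u => (u.2 : ℕ)) h
  have hcard : (Finset.univ ×ˢ Finset.range (D + 1) : Finset (Fin n × ℕ)).card =
      n * (D + 1) := by simp
  rw [← hcard]
  refine Finset.card_le_card_of_injOn (fun v => (v.1, (v.2 : ℕ) - u.2)) ?_ ?_
  · intro v hv
    have hv : v ∈ S := hv
    have := hD u v (by simpa [S] using hu) (by simpa [S] using hv)
    simp only [Finset.coe_product, Finset.coe_univ, Set.mem_prod, Set.mem_univ, true_and,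
      Finset.mem_coe, Finset.mem_range]
    omega
  · intro v hv w hw hvw
    have h1 := hmin v hv
    have h2 := hmin w hw
    simp only [Prod.mk.injEq] at hvw
    exact Prod.ext hvw.1 (Fin.ext (by omega))

/-- A long branch off a trunk yields a long sequence of doubly crossed bands. -/
theorem HasBranchOfLengthGE.exists_doublyCrossed {L : T.Subgraph} (hL : IsSinkTrunk L)
    (hT : T ≤ sinkCylinder n m) (hm : 1 ≤ m) {l q₀ : ℕ} (hq₀ : q₀ ≠ 0 → n * (4 * q₀) < l)
    (hl : HasBranchOfLengthGE L l) : ∃ a < m, ∀ j < q₀, DoublyCrossed (a + 2 * j) T := by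
  rcases Nat.eq_zero_or_pos q₀ with rfl | hpos
  · exact ⟨0, hm, by simp⟩
  obtain ⟨u, v, p, ⟨⟨hp, hu, hv, hpL⟩, -⟩, hlen⟩ := hl
  cases p with
  | nil => exact absurd hu hv
  | cons h q =>
    rw [SimpleGraph.Walk.cons_isPath_iff] at hp
    have hqL : ∀ z ∈ q.support, z ∉ L.verts := fun z hz hzL =>
      hp.2 (hpL z (List.mem_cons_of_mem _ hz) hzL ▸ hz)
    have hs : none ∉ q.support := fun hz => hqL _ hz hL.2.1
    obtain ⟨x, y, hx, hy, hxy⟩ : ∃ x y : Fin n × Fin m, some x ∈ q.support ∧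
        some y ∈ q.support ∧ (x.2 : ℕ) + 4 * q₀ ≤ y.2 := by
      by_contra hcon
      push Not at hcon
      have hle := card_support_le_of_ring_le q hp.1 hs (4 * q₀ - 1) fun x y hx hy => by
        have := hcon x y hx hy
        omega
      rw [SimpleGraph.Walk.length_support, show 4 * q₀ - 1 + 1 = 4 * q₀ by omega] at hle
      rw [SimpleGraph.Walk.length_cons] at hlen
      have := hq₀ hpos.ne'
      omega
    obtain ⟨r, hr⟩ := exists_walk_within_support q hx hy
    have hy2 := y.2.isLt
    have hdouble : ∀ k, (x.2 : ℕ) ≤ k → k < y.2 → CrossedWithin T L.verts k →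
        DoublyCrossed k T := fun k h1 h2 h3 =>
      (crossedWithin_support hT r (fun h' => hs (hr _ h')) h1 h2).doublyCrossed h3
        fun z hz => hqL z (hr z hz)
    -- Of the `4 * q₀` levels spanned, either the trunk crosses the first `2 * q₀`, or its only gap
    -- lies among them and it crosses the rest. Every second level of that half is used, to keep the
    -- bands disjoint.
    by_cases hgap : ∀ k, (x.2 : ℕ) ≤ k → k < x.2 + 2 * q₀ → CrossedWithin T L.verts k
    · exact ⟨x.2, x.2.isLt, fun j hj =>
        hdouble _ (by omega) (by omega) (hgap _ (by omega) (by omega))⟩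
    · push Not at hgap
      obtain ⟨g, hg1, hg2, hg3⟩ := hgap
      exact ⟨x.2 + 2 * q₀, by omega, fun j hj => hdouble _ (by omega) (by omega)
        ((hL.crossedWithin_or hT (by omega) (by omega)).resolve_left hg3)⟩

end Branches

/-! ### Existence of a sink-rooted trunk. -/

section Trunks

variable {n m : ℕ} {T : SimpleGraph (Option (Fin n × Fin m))}

/-- `q` becomes a path from the sink to `v` when the edge from the sink to `w` is prepended. -/
structure IsArm {w v : Fin n × Fin m} (q : T.Walk (some w) (some v)) : Prop where
  adj : T.Adj none (some w)
  isPath : q.IsPath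
  sink_notMem : none ∉ q.support

theorem IsArm.isPath_cons {w v : Fin n × Fin m} {q : T.Walk (some w) (some v)} (hq : IsArm q) :
    (SimpleGraph.Walk.cons hq.adj q).IsPath :=
  (SimpleGraph.Walk.cons_isPath_iff _ _).2 ⟨hq.isPath, hq.sink_notMem⟩

theorem exists_isArm (hT : T ≤ sinkCylinder n m) (hc : T.Connected) (v : Fin n × Fin m) :
    ∃ (w : Fin n × Fin m) (q : T.Walk (some w) (some v)), OnBoundary w ∧ IsArm q := by
  obtain ⟨p, hp⟩ := (hc.preconnected none (some v)).exists_isPath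
  cases p with
  | @cons _ w _ h q =>
    rw [SimpleGraph.Walk.cons_isPath_iff] at hp
    rcases w with _ | w
    · exact absurd h (T.irrefl)
    · exact ⟨w, q, hT h, h, hp.1, hp.2⟩

theorem IsArm.isSinkTrunk {w v : Fin n × Fin m} {q : T.Walk (some w) (some v)} (hq : IsArm q)
    (hring : ∀ k : Fin m, ∃ i : Fin n, some (i, k) ∈ q.support) :
    IsSinkTrunk (SimpleGraph.Walk.cons hq.adj q).toSubgraph := by
  refine ⟨⟨_, _, _, hq.isPath_cons, rfl⟩, SimpleGraph.Walk.start_mem_verts_toSubgraph _,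
    fun k => ?_⟩
  obtain ⟨i, hi⟩ := hring k
  exact ⟨i, (SimpleGraph.Walk.mem_verts_toSubgraph _).2 (List.mem_cons_of_mem _ hi)⟩

/-- In an acyclic graph, arms that start with different edges are disjoint. -/
theorem IsArm.disjoint (hT : T.IsAcyclic) {w v w' v' : Fin n × Fin m}
    {q : T.Walk (some w) (some v)} {q' : T.Walk (some w') (some v')} (hq : IsArm q)
    (hq' : IsArm q') (hww : w ≠ w') {z : Option (Fin n × Fin m)} (hz : z ∈ q.support) :
    z ∉ q'.support := by
  classical
  intro hz'
  have h1 : (SimpleGraph.Walk.cons hq.adj (q.takeUntil z hz)).IsPath :=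
    (SimpleGraph.Walk.cons_isPath_iff _ _).2 ⟨hq.isPath.takeUntil hz,
      fun h => hq.sink_notMem (q.support_takeUntil_subset_support hz h)⟩
  have h2 : (SimpleGraph.Walk.cons hq'.adj (q'.takeUntil z hz')).IsPath :=
    (SimpleGraph.Walk.cons_isPath_iff _ _).2 ⟨hq'.isPath.takeUntil hz',
      fun h => hq'.sink_notMem (q'.support_takeUntil_subset_support hz' h)⟩
  -- Two paths from the sink to `z` coincide, so their second vertices `w` and `w'` would agree.
  have h := congrArg Subtype.val ((hT.subsingleton_path _ _).elim ⟨_, h1⟩ ⟨_, h2⟩)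
  have hsnd := congrArg SimpleGraph.Walk.snd h
  simp only [SimpleGraph.Walk.snd_cons] at hsnd
  exact hww (Option.some.inj hsnd)

theorem IsArm.isSinkTrunk_append (hT : T.IsAcyclic) {w v w' v' : Fin n × Fin m}
    {q : T.Walk (some w) (some v)} {q' : T.Walk (some w') (some v')} (hq : IsArm q)
    (hq' : IsArm q') (hww : w ≠ w')
    (hring : ∀ k : Fin m, ∃ i : Fin n, some (i, k) ∈ q.support ∨ some (i, k) ∈ q'.support) :
    ∃ L : T.Subgraph, IsSinkTrunk L := by
  let p := (SimpleGraph.Walk.cons hq.adj q).reverse.append (SimpleGraph.Walk.cons hq'.adj q')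
  have hsupp : ∀ z, z ∈ p.support ↔ z = none ∨ z ∈ q.support ∨ z ∈ q'.support := by
    intro z
    simp only [p, SimpleGraph.Walk.mem_support_append_iff, SimpleGraph.Walk.support_reverse,
      List.mem_reverse, SimpleGraph.Walk.support_cons, List.mem_cons]
    tauto
  have hp : p.IsPath := by
    rw [SimpleGraph.Walk.isPath_def, SimpleGraph.Walk.support_append,
      SimpleGraph.Walk.support_reverse, SimpleGraph.Walk.support_cons,
      SimpleGraph.Walk.support_cons, List.tail_cons, List.nodup_append]
    refine ⟨List.nodup_reverse.2 (List.nodup_cons.2 ⟨hq.sink_notMem, hq.isPath.support_nodup⟩),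
      hq'.isPath.support_nodup, ?_⟩
    rintro x hx _ hy rfl
    rw [List.mem_reverse, List.mem_cons] at hx
    rcases hx with rfl | hx
    · exact hq'.sink_notMem hy
    · exact hq.disjoint hT hq' hww hx hy
  refine ⟨p.toSubgraph, ⟨_, _, p, hp, rfl⟩, ?_, fun k => ?_⟩
  · rw [p.mem_verts_toSubgraph, hsupp]
    exact Or.inl rfl
  · obtain ⟨i, hi⟩ := hring k
    exact ⟨i, by rw [p.mem_verts_toSubgraph, hsupp]; exact Or.inr hi⟩

/-- Each ring is reached by an arm starting in `R_0` or in `R_{m-1}`. Either one arm traverses the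
whole cylinder, or the type of arm switches between two adjacent rings, and the two arms there cover
all rings together. -/
theorem exists_isSinkTrunk (hn : 1 ≤ n) (hm : 1 ≤ m) (hTG : T ≤ sinkCylinder n m)
    (hT : T.IsTree) : ∃ L : T.Subgraph, IsSinkTrunk L := by
  have hbelow : ∀ {w v : Fin n × Fin m} {q : T.Walk (some w) (some v)}, IsArm q →
      (w.2 : ℕ) = 0 → ∀ k : Fin m, k ≤ v.2 → ∃ i : Fin n, some (i, k) ∈ q.support := by
    intro w v q hq hw k hk
    exact exists_mem_support_ring hTG q hq.sink_notMem (by rw [Fin.le_def]; omega) hk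
  have habove : ∀ {w v : Fin n × Fin m} {q : T.Walk (some w) (some v)}, IsArm q →
      (w.2 : ℕ) + 1 = m → ∀ k : Fin m, v.2 ≤ k → ∃ i : Fin n, some (i, k) ∈ q.support := by
    intro w v q hq hw k hk
    obtain ⟨i, hi⟩ := exists_mem_support_ring hTG q.reverse (by simpa using hq.sink_notMem) hk
      (by rw [Fin.le_def]; omega)
    exact ⟨i, by simpa using hi⟩
  let U : ℕ → Prop := fun k => ∃ (w v : Fin n × Fin m) (q : T.Walk (some w) (some v)),
    (w.2 : ℕ) = 0 ∧ (v.2 : ℕ) = k ∧ IsArm q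
  let D : ℕ → Prop := fun k => ∃ (w v : Fin n × Fin m) (q : T.Walk (some w) (some v)),
    (w.2 : ℕ) + 1 = m ∧ (v.2 : ℕ) = k ∧ IsArm q
  have hUD : ∀ k < m, U k ∨ D k := by
    intro k hk
    obtain ⟨w, q, hw | hw, hq⟩ := exists_isArm hTG hT.connected (⟨0, hn⟩, ⟨k, hk⟩)
    · exact Or.inl ⟨w, _, q, hw, rfl, hq⟩
    · exact Or.inr ⟨w, _, q, hw, rfl, hq⟩
  by_cases hU : U (m - 1)
  · obtain ⟨w, v, q, hw, hv, hq⟩ := hU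
    exact ⟨_, hq.isSinkTrunk fun k => hbelow hq hw k (by rw [Fin.le_def]; omega)⟩
  by_cases hD : D 0
  · obtain ⟨w, v, q, hw, hv, hq⟩ := hD
    exact ⟨_, hq.isSinkTrunk fun k => habove hq hw k (by rw [Fin.le_def]; omega)⟩
  obtain ⟨a, ha, hUa, hUa'⟩ : ∃ a, a + 1 < m ∧ U a ∧ ¬ U (a + 1) := by
    by_contra hcon
    push Not at hcon
    have hall : ∀ a < m, U a := by
      intro a
      induction a with
      | zero => exact fun h => (hUD 0 h).resolve_right hD
      | succ a ih => exact fun h => hcon a h (ih (by omega))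
    exact hU (hall _ (by omega))
  obtain ⟨w, v, q, hw, hv, hq⟩ := hUa
  obtain ⟨w', v', q', hw', hv', hq'⟩ := (hUD _ ha).resolve_left hUa'
  refine hq.isSinkTrunk_append hT.isAcyclic hq' (by rintro rfl; omega) fun k => ?_
  rcases le_or_gt (k : ℕ) a with hk | hk
  · exact (hbelow hq hw k (by rw [Fin.le_def]; omega)).imp fun _ => Or.inl
  · exact (habove hq' hw' k (by rw [Fin.le_def]; omega)).imp fun _ => Or.inr

end Trunks

/-! ### From counting to probability, and the union bound. -/

section Probability

theorem ust_real_apply {V : Type*} [Finite V] {G : SimpleGraph V} (hG : G.Connected)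
    [Fintype (SpanningTree G)] (A : Set (SpanningTree G)) [DecidablePred (· ∈ A)] :
    (ust G hG).real A =
      (Finset.univ.filter (· ∈ A)).card / Fintype.card (SpanningTree G) := by
  have : Nonempty (SpanningTree G) := SpanningTree.nonempty hG
  obtain rfl : ‹Fintype (SpanningTree G)› = Fintype.ofFinite _ := Subsingleton.elim _ _
  let : Fintype (SpanningTree G) := Fintype.ofFinite _
  have h := PMF.toMeasure_uniformOfFintype_apply (α := SpanningTree G) A trivial
  rw [ust, Measure.real, h, ENNReal.toReal_div, ENNReal.toReal_natCast, ENNReal.toReal_natCast,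
    ← Fintype.card_subtype]

theorem ust_forall_doublyCrossed_le {n m : ℕ} (hn : 1 ≤ n) (a q : ℕ) :
    (ust (sinkCylinder n m) (sinkCylinder_connected n m)).real
        {T | ∀ j < q, DoublyCrossed (a + 2 * j) T.1} ≤
      ((bandCount n : ℝ) / (bandCount n + 1)) ^ q := by
  classical
  have : Fintype (SpanningTree (sinkCylinder n m)) := Fintype.ofFinite _
  have : Nonempty (SpanningTree (sinkCylinder n m)) :=
    SpanningTree.nonempty (sinkCylinder_connected n m)
  rw [ust_real_apply, div_pow, div_le_div_iff₀ (by exact_mod_cast Fintype.card_pos)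
    (by positivity), mul_comm]
  exact_mod_cast card_forall_doublyCrossed_le hn a q

end Probability

theorem theorem2 (n : ℕ) (hn : 1 ≤ n) :
    ∃ C θ : ℝ, 0 < C ∧ 0 < θ ∧ θ < 1 ∧
      ∀ m : ℕ, 1 ≤ m →
        ∃ L : (T : SpanningTree (sinkCylinder n m)) → T.1.Subgraph,
          (∀ T, IsSinkTrunk (L T)) ∧
          ∀ l : ℕ,
            (ust (sinkCylinder n m) (sinkCylinder_connected n m)).real
                {T | HasBranchOfLengthGE (L T) l}
              ≤ m * C * θ ^ l := by
  let r : ℝ := (bandCount n : ℝ) / (bandCount n + 1)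
  have hN : (0 : ℝ) < bandCount n := by simp [bandCount]
  have hr0 : 0 < r := by positivity
  have hr1 : r < 1 := by rw [div_lt_one (by positivity)]; linarith
  -- One factor `r` is gained per `4 * n` edges of the branch.
  let θ : ℝ := r ^ ((4 * n : ℕ) : ℝ)⁻¹
  have hθ0 : 0 < θ := Real.rpow_pos_of_pos hr0 _
  have hθ1 : θ < 1 := Real.rpow_lt_one hr0.le hr1 (by
    have : 0 < n := hn
    positivity)
  have hθr : θ ^ (4 * n) = r := Real.rpow_inv_natCast_pow hr0.le (by omega)
  refine ⟨(θ ^ (5 * n))⁻¹, θ, by positivity, hθ0, hθ1, fun m hm => ?_⟩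
  choose L hL using fun T : SpanningTree (sinkCylinder n m) =>
    exists_isSinkTrunk hn hm T.2.1 T.2.2
  refine ⟨L, hL, fun l => ?_⟩
  -- Chosen so that `n * (4 * q) < l` when `q ≠ 0`; short branches give `q = 0` by truncation.
  -- Rounding loses at most `5 * n` edges, whence the constant `(θ ^ (5 * n))⁻¹`.
  let q := (l / n - 1) / 4
  have hdiv := Nat.div_add_mod l n
  have hmod := Nat.mod_lt l hn
  have hq : q ≠ 0 → n * (4 * q) < l := by
    intro hq
    have h1 : 4 * q + 1 ≤ l / n := by omega
    have := Nat.mul_le_mul_left n h1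
    rw [mul_add] at this
    omega
  have hq' : l ≤ 4 * n * q + 5 * n := by
    have h1 : l / n ≤ 4 * q + 4 := by omega
    have := Nat.mul_le_mul_left n h1
    nlinarith
  have hfin : IsFiniteMeasure (ust (sinkCylinder n m) (sinkCylinder_connected n m)) := by
    unfold ust
    infer_instance
  have hsub : {T | HasBranchOfLengthGE (L T) l} ⊆ ⋃ a ∈ Finset.range m,
      {T : SpanningTree (sinkCylinder n m) | ∀ j < q, DoublyCrossed (a + 2 * j) T.1} := by
    intro T hT
    obtain ⟨a, ha, h⟩ := HasBranchOfLengthGE.exists_doublyCrossed (hL T) T.2.1 hm hq hT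
    exact Set.mem_biUnion (Finset.mem_coe.2 (Finset.mem_range.2 ha)) h
  calc _ ≤ _ := measureReal_mono hsub (measure_ne_top _ _)
    _ ≤ _ := measureReal_biUnion_finset_le _ _
    _ ≤ ∑ _a ∈ Finset.range m, r ^ q :=
      Finset.sum_le_sum fun a _ => ust_forall_doublyCrossed_le hn a q
    _ = m * r ^ q := by simp
    _ ≤ m * ((θ ^ (5 * n))⁻¹ * θ ^ l) := by
      gcongr
      rw [inv_mul_eq_div, le_div_iff₀ (by positivity), ← hθr, ← pow_mul, ← pow_add]
      exact pow_le_pow_of_le_one hθ0.le hθ1.le hq'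
    _ = _ := by ring
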